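/- Lemma. Let $G=(V,E)$ be a finite simple undirected unweighted graph with $n=|V|$ vertices and Laplacian $L$. For $u,v\in V$ let $R^G_{uv}=(\chi_u-\chi_v)^\top L^{+}(\chi_u-\chi_v)$ be the effective resistance between $u$ and $v$ if they lie in the same connected component of $G$, and $R^G_{uv}=+\infty$ otherwise; here $L^{+}$ is the Moore-Penrose pseudoinverse of $L$ and $\chi_u$ is the indicator vector of $u$. For $S\subseteq V$ let $\mathrm{diam}_{\mathrm{eff}}^{\mathrm{Ind}}(S)=\max_{u,v\in S}R^{G_S}_{uv}$, where $G_S$ is the subgraph of $G$ induced by $S$. Let $\Delta,\beta>0$ be real, let $k\ge 1$ be an integer, and suppose that 1. $\Delta<\dfrac{\beta}{400\sqrt{k}}$ and $\beta<\dfrac{1}{\log n}$ (that is, $\beta\log n<1$), where $\log$ is the natural logarithm; 2. $V=C_1\cup\dots\cup C_k$ with the $C_i$ pairwise disjoint, and $\mathrm{diam}_{\mathrm{eff}}^{\mathrm{Ind}}(C_i)\le\Delta$ for every $i\in[k]$. Then there is a set $A\subseteq[k]$ with $|A|\le 8\sqrt{k}\,\log n$ such that the number of edges $\{u,v\}\in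 E$ with $R^G_{uv}\ge\beta$ that join two distinct clusters with indices in $[k]\setminus A$ is at most $\dfrac{k\log n}{\beta}$. -/

import Mathlib

noncomputable section

/-- The four Penrose equations: `X` is the Moore-Penrose pseudoinverse of the real matrix `M`. -/
def IsMoorePenrose {V : Type*} [Fintype V] (M X : Matrix V V ℝ) : Prop :=
  M * X * M = M ∧ X * M * X = X ∧ (M * X).transpose = M * X ∧ (X * M).transpose = X * M

/-- The Moore-Penrose pseudoinverse of a real symmetric matrix: in an orthonormal eigenbasis, invert
the nonzero eigenvalues and keep the zero ones (Lean's `0⁻¹ = 0` is exactly what is wanted). -/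
def symmPinv {V : Type*} [Fintype V] [DecidableEq V] {M : Matrix V V ℝ} (hM : M.IsHermitian) :
    Matrix V V ℝ :=
  (hM.eigenvectorUnitary : Matrix V V ℝ) * Matrix.diagonal (fun i => (hM.eigenvalues i)⁻¹) *
    star (hM.eigenvectorUnitary : Matrix V V ℝ)

theorem symmPinv_isMoorePenrose {V : Type*} [Fintype V] [DecidableEq V] {M : Matrix V V ℝ}
    (hM : M.IsHermitian) : IsMoorePenrose M (symmPinv hM) := by
  have hs : M = (hM.eigenvectorUnitary : Matrix V V ℝ) * Matrix.diagonal hM.eigenvalues *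
      star (hM.eigenvectorUnitary : Matrix V V ℝ) := by
    have h := hM.spectral_theorem
    simpa [Unitary.conjStarAlgAut_apply, Function.comp_def] using h
  unfold IsMoorePenrose symmPinv
  have hU : star (hM.eigenvectorUnitary : Matrix V V ℝ) * (hM.eigenvectorUnitary : Matrix V V ℝ)
      = 1 := Unitary.coe_star_mul_self _
  generalize (hM.eigenvectorUnitary : Matrix V V ℝ) = U at hs hU ⊢
  generalize hM.eigenvalues = d at hs ⊢
  subst hs
  have key : ∀ a b : V → ℝ, (U * Matrix.diagonal a * star U) * (U * Matrix.diagonal b * star U)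
      = U * Matrix.diagonal (fun i => a i * b i) * star U := by
    intro a b
    calc _ = U * Matrix.diagonal a * (star U * U) * Matrix.diagonal b * star U := by
          simp only [Matrix.mul_assoc]
      _ = _ := by rw [hU, Matrix.mul_one, Matrix.mul_assoc U, Matrix.diagonal_mul_diagonal]
  have symm : ∀ a : V → ℝ, (U * Matrix.diagonal a * star U).transpose
      = U * Matrix.diagonal a * star U := by
    intro a
    simp [Matrix.star_eq_conjTranspose, Matrix.transpose_mul, Matrix.mul_assoc]
  refine ⟨?_, ?_, ?_, ?_⟩
  · rw [key, key]; congr; ext i; exact mul_inv_mul_cancel _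
  · rw [key, key]; congr; ext i
    by_cases h : d i = 0 <;> simp [h]
  · rw [key, symm]
  · rw [key, symm]

open Classical in
/-- The Moore-Penrose pseudoinverse `L⁺` of the Laplacian of an unweighted graph. -/
def lapPinv {V : Type*} [Fintype V] (G : SimpleGraph V) : Matrix V V ℝ :=
  symmPinv (SimpleGraph.posSemidef_lapMatrix ℝ G).isHermitian

open Classical in
/-- The effective resistance `R_{uv} = b_{uv}ᵀ L⁺ b_{uv}`, where `b_{uv} = χ_u - χ_v`. No current
can flow between different connected components, and the resistance there is infinite. -/
def effRes {V : Type*} [Fintype V] (G : SimpleGraph V) (u v : V) : EReal :=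
  if G.Reachable u v then
    (((Pi.single u 1 - Pi.single v 1 : V → ℝ) ⬝ᵥ
      (lapPinv G).mulVec (Pi.single u 1 - Pi.single v 1 : V → ℝ) : ℝ) : EReal)
  else ⊤

open Classical in
/-- The effective resistance diameter of the subgraph induced by `S`. -/
def indEffDiam {V : Type*} [Fintype V] (G : SimpleGraph V) (S : Set V) : EReal :=
  ⨆ (u : S) (v : S), effRes (G.induce S) u v

/-- The edges of `G` of effective resistance (in `G`) at least `β` that join two distinct clusters
whose indices lie outside `A`. -/
def heavyLightEdges {V : Type*} [Fintype V] (G : SimpleGraph V) {k : ℕ} (C : Fin k → Set V)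
    (β : ℝ) (A : Finset (Fin k)) : Set (Sym2 V) :=
  {e | ∃ u v : V, e = s(u, v) ∧ G.Adj u v ∧ (β : EReal) ≤ effRes G u v ∧
    ∃ i j : Fin k, i ≠ j ∧ i ∉ A ∧ j ∉ A ∧ u ∈ C i ∧ v ∈ C j}

end

open Matrix Finset

/-! Contract each cluster to a point and keep only the `m` heavy edges between clusters. By Foster's
averaging, some heavy edge `uv` has resistance at most `k / m` in this contracted graph. Its unit
current has energy at most `k / m`, hence total absolute flow at most `√k` by Cauchy-Schwarz, and at
most 2 units touch any cluster (`sum_weight_abs_sub_le_two`). Completing this current inside the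
clusters, whose resistance diameter is at most `Δ`, adds energy at most `12 Δ √k`. Thus `β ≤ k / m +
12 Δ √k`, and the last term is below `0.03 β`, so `m ≤ k / (0.97 β)`. For `n ≥ 3`, `log n` exceeds
`1 / 0.97`, and `A = ∅` works; only `n = 2` needs a nonempty `A`. The lifted flow is never built: it
is paired with the potential of `G` (`potential_drop_le_add`). -/

/-! ### Pseudoinverses and Foster's averaging. -/

theorem IsMoorePenrose.mulVec_transpose_mulVec {κ : Type*} [Fintype κ] {M X : Matrix κ κ ℝ}
    (h : IsMoorePenrose M X) (hM : Mᵀ = M) {b : κ → ℝ}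
    (hb : ∀ z : κ → ℝ, M *ᵥ z = 0 → b ⬝ᵥ z = 0) : M *ᵥ (Xᵀ *ᵥ b) = b := by
  obtain ⟨h1, h2, -, h4⟩ := h
  have hP : (X * M) *ᵥ b = M *ᵥ (Xᵀ *ᵥ b) := by
    rw [← h4, transpose_mul, hM, mulVec_mulVec]
  rw [← hP]
  -- The residual of the projection `X * M` lies in the kernel of `M`, so it is orthogonal to `b`
  -- and to the range of `M`, hence to itself.
  have hz : M *ᵥ (b - (X * M) *ᵥ b) = 0 := by
    rw [mulVec_sub, mulVec_mulVec, ← Matrix.mul_assoc, h1, sub_self]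
  have h5 := hb _ hz
  have h6 : ((X * M) *ᵥ b) ⬝ᵥ (b - (X * M) *ᵥ b) = 0 := by
    generalize b - (X * M) *ᵥ b = z at hz
    rw [hP, ← vecMul_transpose, hM, ← dotProduct_mulVec, hz, dotProduct_zero]
  have h7 : (b - (X * M) *ᵥ b) ⬝ᵥ (b - (X * M) *ᵥ b) = 0 := by
    rw [sub_dotProduct, h5, h6, sub_zero]
  exact (sub_eq_zero.1 (dotProduct_self_eq_zero.1 h7)).symm

/-- `X * M` is a symmetric idempotent, so each diagonal entry `d` is the sum of squares of its row;
thus `d ^ 2 ≤ d` and `d ≤ 1`. -/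
theorem IsMoorePenrose.trace_mul_le {κ : Type*} [Fintype κ] {M X : Matrix κ κ ℝ}
    (h : IsMoorePenrose M X) : (X * M).trace ≤ Fintype.card κ := by
  obtain ⟨-, h2, -, h4⟩ := h
  have hi : (X * M) * (X * M) = X * M := by rw [← Matrix.mul_assoc, h2]
  have hd : ∀ i, (X * M) i i ≤ 1 := by
    intro i
    have h5 : (X * M) i i = ∑ j, (X * M) i j * (X * M) j i := by
      conv_lhs => rw [← hi]
      rw [Matrix.mul_apply]
    have h6 : (X * M) i i * (X * M) i i ≤ ∑ j, (X * M) i j * (X * M) j i := by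
      refine single_le_sum (f := fun j => (X * M) i j * (X * M) j i) (fun j _ => ?_) (mem_univ i)
      have h7 : (X * M) j i = (X * M) i j := by
        conv_lhs => rw [← h4]
        rfl
      rw [h7]; exact mul_self_nonneg _
    rw [← h5] at h6
    nlinarith
  calc (X * M).trace ≤ ∑ _i : κ, (1 : ℝ) := sum_le_sum fun i _ => hd i
    _ = Fintype.card κ := by simp

/-- Foster's averaging argument for a weighted family of vectors. -/
theorem exists_dotProduct_le_of_weighted_family {ι κ : Type*} [Fintype ι] [Fintype κ]
    (w : ι → ℝ) (hw : ∀ e, 0 ≤ w e) (hpos : 0 < ∑ e, w e) (b : ι → κ → ℝ) :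
    ∃ e, 0 < w e ∧ ∃ p : κ → ℝ,
      (∀ z, ∑ e', w e' * (b e' ⬝ᵥ p) * (b e' ⬝ᵥ z) = b e ⬝ᵥ z) ∧
      (∑ e', w e') * (b e ⬝ᵥ p) ≤ Fintype.card κ := by
  classical
  set M : Matrix κ κ ℝ := ∑ e, w e • vecMulVec (b e) (b e) with hMdef
  have hMt : Mᵀ = M := by
    simp [hMdef, transpose_sum, transpose_smul, transpose_vecMulVec]
  have hMz : ∀ p z : κ → ℝ, (M *ᵥ p) ⬝ᵥ z = ∑ e, w e * (b e ⬝ᵥ p) * (b e ⬝ᵥ z) := by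
    intro p z
    simp [hMdef, sum_mulVec, sum_dotProduct, smul_mulVec, vecMulVec_mulVec, mul_assoc]
  have hH : M.IsHermitian := by
    rw [IsHermitian, conjTranspose_eq_transpose_of_trivial, hMt]
  have hX := symmPinv_isMoorePenrose hH
  set X := symmPinv hH
  have hker : ∀ e, 0 < w e → ∀ z, M *ᵥ z = 0 → b e ⬝ᵥ z = 0 := by
    intro e he z hz
    have h1 := hMz z z
    rw [hz, zero_dotProduct] at h1
    have h2 := (sum_eq_zero_iff_of_nonneg (fun e _ => by
      rw [mul_assoc]; exact mul_nonneg (hw e) (mul_self_nonneg _))).1 h1.symm e (mem_univ e)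
    simpa [he.ne'] using h2
  have htr : ∑ e, w e * (b e ⬝ᵥ Xᵀ *ᵥ b e) = (X * M).trace := by
    simp only [hMdef, Matrix.mul_sum, trace_sum, Matrix.mul_smul, trace_smul, mul_vecMulVec,
      trace_vecMulVec, smul_eq_mul]
    refine sum_congr rfl fun e _ => ?_
    rw [mulVec_transpose, dotProduct_comm, ← dotProduct_mulVec, dotProduct_comm]
  obtain ⟨e, he, hle⟩ : ∃ e, 0 < w e ∧
      (∑ e', w e') * (b e ⬝ᵥ Xᵀ *ᵥ b e) ≤ Fintype.card κ := by
    by_contra! hcon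
    have h1 : ∑ e, w e * Fintype.card κ < ∑ e, w e * ((∑ e', w e') * (b e ⬝ᵥ Xᵀ *ᵥ b e)) := by
      obtain ⟨e₀, -, he₀⟩ := exists_lt_of_sum_lt (s := univ) (f := fun _ => (0 : ℝ)) (g := w)
        (by simpa using hpos)
      refine sum_lt_sum (fun e _ => ?_)
        ⟨e₀, mem_univ _, mul_lt_mul_of_pos_left (hcon e₀ he₀) he₀⟩
      rcases (hw e).eq_or_lt with h | h
      · simp [← h]
      · exact mul_le_mul_of_nonneg_left (hcon e h).le h.le
    have h2 : ∑ e, w e * ((∑ e', w e') * (b e ⬝ᵥ Xᵀ *ᵥ b e)) =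
        (∑ e', w e') * ∑ e, w e * (b e ⬝ᵥ Xᵀ *ᵥ b e) := by
      rw [mul_sum]; exact sum_congr rfl fun e _ => by ring
    rw [h2, htr, ← sum_mul] at h1
    exact absurd hX.trace_mul_le (not_le.2 (lt_of_mul_lt_mul_left h1 hpos.le))
  refine ⟨e, he, Xᵀ *ᵥ b e, fun z => ?_, hle⟩
  rw [← hMz, hX.mulVec_transpose_mulVec hMt (hker e he)]

/-! ### Dirichlet energy and effective resistance. -/

/-- The Dirichlet energy of a potential. -/
noncomputable def SimpleGraph.dirichletEnergy {V : Type*} [Fintype V] (G : SimpleGraph V) (x : V → ℝ) : ℝ :=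
  open Classical in (∑ a, ∑ b, if G.Adj a b then (x a - x b) ^ 2 else 0) / 2

theorem SimpleGraph.dirichletEnergy_nonneg {V : Type*} [Fintype V] (G : SimpleGraph V)
    (x : V → ℝ) : 0 ≤ G.dirichletEnergy x := by
  unfold SimpleGraph.dirichletEnergy
  positivity

open Classical in
theorem SimpleGraph.dirichletEnergy_eq_dotProduct {V : Type*} [Fintype V] (G : SimpleGraph V)
    (x : V → ℝ) : G.dirichletEnergy x = x ⬝ᵥ (G.lapMatrix ℝ *ᵥ x) := by
  rw [SimpleGraph.dirichletEnergy, ← G.lapMatrix_toLinearMap₂' ℝ x, Matrix.toLinearMap₂'_apply']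

open Classical in
/-- The electrical potential of a unit current between two connected vertices. -/
theorem exists_potential_of_reachable {V : Type*} [Fintype V] {G : SimpleGraph V} {u v : V}
    (h : G.Reachable u v) :
    ∃ p : V → ℝ, G.lapMatrix ℝ *ᵥ p = Pi.single u 1 - Pi.single v 1 ∧
      effRes G u v = ((p u - p v : ℝ) : EReal) := by
  have hMP := symmPinv_isMoorePenrose (SimpleGraph.posSemidef_lapMatrix ℝ G).isHermitian
  set X := symmPinv (SimpleGraph.posSemidef_lapMatrix ℝ G).isHermitian with hXdef
  set b : V → ℝ := Pi.single u 1 - Pi.single v 1 with hb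
  have hdot : ∀ z : V → ℝ, b ⬝ᵥ z = z u - z v := fun z => by
    simp [hb, sub_dotProduct]
  refine ⟨Xᵀ *ᵥ b, hMP.mulVec_transpose_mulVec (G.isSymm_lapMatrix (R := ℝ)).eq fun z hz => ?_, ?_⟩
  · rw [hdot, (G.lapMatrix_mulVec_eq_zero_iff_forall_reachable).1 hz u v h, sub_self]
  · rw [effRes, if_pos h, ← hdot, mulVec_transpose, dotProduct_comm b (b ᵥ* X),
      ← dotProduct_mulVec]
    rfl

open Classical in
-- Cauchy-Schwarz for the energy form, read off from the nonnegative energy of `x - t • p`. Dividing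
-- by `D` rather than by the resistance keeps the case `u = v` harmless.
theorem sq_sub_le_mul_dirichletEnergy {V : Type*} [Fintype V] {G : SimpleGraph V} {u v : V}
    {D : ℝ} (hD : 0 < D) (h : effRes G u v ≤ (D : EReal)) (x : V → ℝ) :
    (x u - x v) ^ 2 ≤ D * G.dirichletEnergy x := by
  by_cases hr : G.Reachable u v
  · obtain ⟨p, hp, hR⟩ := exists_potential_of_reachable hr
    rw [hR, EReal.coe_le_coe_iff] at h
    set t := (x u - x v) / D with ht
    have h0 := G.dirichletEnergy_nonneg (x - t • p)
    have hs : p ⬝ᵥ (G.lapMatrix ℝ *ᵥ x) = x u - x v := by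
      rw [dotProduct_mulVec, ← mulVec_transpose, (G.isSymm_lapMatrix (R := ℝ)).eq]
      rw [hp]; simp [sub_dotProduct]
    have hq : x ⬝ᵥ (G.lapMatrix ℝ *ᵥ p) = x u - x v := by
      rw [hp]; simp [dotProduct_sub]
    have hpp : p ⬝ᵥ (G.lapMatrix ℝ *ᵥ p) = p u - p v := by
      rw [hp]; simp [dotProduct_sub]
    have hE : G.dirichletEnergy (x - t • p) =
        G.dirichletEnergy x - 2 * t * (x u - x v) + t ^ 2 * (p u - p v) := by
      rw [G.dirichletEnergy_eq_dotProduct, G.dirichletEnergy_eq_dotProduct]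
      simp only [mulVec_sub, mulVec_smul, dotProduct_sub, sub_dotProduct, smul_dotProduct,
        dotProduct_smul, smul_eq_mul, hs, hq, hpp]
      ring
    rw [hE] at h0
    have h1 : t ^ 2 * (p u - p v) ≤ t ^ 2 * D := mul_le_mul_of_nonneg_left h (sq_nonneg _)
    have h2 : x u - x v = t * D := by rw [ht]; field_simp
    rw [h2] at h0 ⊢
    nlinarith
  · rw [effRes, if_neg hr, top_le_iff] at h
    exact absurd h (EReal.coe_ne_top D)

/-! ### Unit currents on the contracted graph. -/

/-- Current runs downhill, so every edge crosses a level cut of `p` in the same direction, and a cut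
carries at most one unit. The test function `z` adds the cuts just above and just below the level of
`i`; each edge at `i` with nonzero current crosses one of them. -/
theorem sum_weight_abs_sub_le_two {ι κ : Type*} [Fintype ι] [DecidableEq κ]
    {w : ι → ℝ} (hw : ∀ e, 0 ≤ w e) (src dst : ι → κ) {p : κ → ℝ} {s t : κ}
    (hp : ∀ z : κ → ℝ,
      ∑ e, w e * (p (src e) - p (dst e)) * (z (src e) - z (dst e)) = z s - z t) (i : κ) :
    ∑ e, w e * |p (src e) - p (dst e)| *
      ((if src e = i then 1 else 0) + (if dst e = i then 1 else 0)) ≤ 2 := by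
  set z : κ → ℝ := fun j => (if p i < p j then 1 else 0) + (if p i ≤ p j then 1 else 0) with hz
  have hz2 : ∀ j, z j ≤ 2 := fun j => by
    simp only [hz]; split_ifs <;> norm_num
  have hz0 : ∀ j, 0 ≤ z j := fun j => by
    simp only [hz]; split_ifs <;> norm_num
  calc _ ≤ ∑ e, w e * (p (src e) - p (dst e)) * (z (src e) - z (dst e)) := by
        refine sum_le_sum fun e _ => ?_
        rw [mul_assoc, mul_assoc]
        refine mul_le_mul_of_nonneg_left ?_ (hw e)
        generalize src e = j
        generalize dst e = l
        simp only [hz]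
        rcases lt_trichotomy (p j) (p l) with h | h | h
        · rw [abs_of_neg (sub_neg.2 h)]
          by_cases hj : j = i <;> by_cases hl : l = i
          · subst hj; subst hl; simp
          · subst hj; simp [h, h.le, hl]
          · subst hl; simp [hj, h.not_ge, h.not_gt]
          · simp only [hj, hl, if_false, add_zero, mul_zero]
            refine mul_nonneg_of_nonpos_of_nonpos (sub_nonpos.2 h.le) (sub_nonpos.2 ?_)
            gcongr ?_ + ?_ <;> split_ifs <;> linarith
        · simp [h]
        · rw [abs_of_pos (sub_pos.2 h)]
          by_cases hj : j = i <;> by_cases hl : l = i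
          · subst hj; subst hl; simp
          · subst hj; simp [hl, h.not_ge, h.not_gt]
          · subst hl; simp [h, h.le, hj]
          · simp only [hj, hl, if_false, add_zero, mul_zero]
            refine mul_nonneg (sub_nonneg.2 h.le) (sub_nonneg.2 ?_)
            gcongr ?_ + ?_ <;> split_ifs <;> linarith
    _ = z s - z t := hp z
    _ ≤ 2 := by linarith [hz2 s, hz0 t]

/-- Lifting a unit current between clusters to the vertices costs little when the clusters have
small resistance diameter. -/
theorem potential_drop_le_add {ι V κ : Type*} [Fintype ι] [Fintype κ] [Nonempty κ]
    {w : ι → ℝ} (hw : ∀ e, 0 ≤ w e) (src dst : ι → V) (c : V → κ) {p : κ → ℝ} {u v : V}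
    (huv : c u ≠ c v)
    (hp : ∀ z : κ → ℝ, ∑ e, w e * (p (c (src e)) - p (c (dst e))) *
      (z (c (src e)) - z (c (dst e))) = z (c u) - z (c v))
    (hr : (∑ e, w e) * (p (c u) - p (c v)) ≤ Fintype.card κ)
    {x : V → ℝ} {y sp E : κ → ℝ} {D : ℝ} (hD : 0 < D)
    (hsp : ∀ a, |x a - y (c a)| ≤ sp (c a)) (hE : ∀ i, sp i ^ 2 ≤ D * E i)
    (hx : ∑ e, w e * (x (src e) - x (dst e)) ^ 2 + ∑ i, E i ≤ x u - x v) :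
    x u - x v ≤ p (c u) - p (c v) + 12 * D * √(Fintype.card κ) := by
  classical
  set f : ι → ℝ := fun e => p (c (src e)) - p (c (dst e)) with hf
  set T : κ → ℝ := fun i => ∑ e, w e * |f e| *
      ((if c (src e) = i then 1 else 0) + (if c (dst e) = i then 1 else 0)) with hT
  set g : κ → ℝ := fun i => T i + ((if c u = i then 1 else 0) + (if c v = i then 1 else 0)) with hg
  have hk : 1 ≤ √(Fintype.card κ : ℝ) := by
    rw [Real.one_le_sqrt]; exact_mod_cast Fintype.card_pos
  have hT2 : ∀ i, T i ≤ 2 := sum_weight_abs_sub_le_two hw _ _ hp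
  have hT0 : ∀ i, 0 ≤ T i := fun i => sum_nonneg fun e _ =>
    mul_nonneg (mul_nonneg (hw e) (abs_nonneg _)) (by positivity)
  have hg0 : ∀ i, 0 ≤ g i := fun i => add_nonneg (hT0 i) (by positivity)
  -- At most 2 from the current, plus 1 if the cluster contains an endpoint; it cannot contain both.
  have hg3 : ∀ i, g i ≤ 3 := by
    intro i
    have := hT2 i
    simp only [hg]
    split_ifs with h1 h2
    · exact absurd (h1.trans h2.symm) huv
    all_goals linarith
  have hff : ∑ e, w e * f e ^ 2 = p (c u) - p (c v) := by
    rw [← hp p]; exact sum_congr rfl fun e _ => by simp only [hf]; ring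
  have hsumT : ∑ i, T i = 2 * ∑ e, w e * |f e| := by
    simp only [hT]
    rw [sum_comm, mul_sum]
    refine sum_congr rfl fun e _ => ?_
    rw [← mul_sum, sum_add_distrib, sum_ite_eq, sum_ite_eq]
    simp; ring
  have hflow : ∑ e, w e * |f e| ≤ √(Fintype.card κ) := by
    refine Real.le_sqrt_of_sq_le (le_trans ?_ hr)
    rw [← hff]
    refine sum_sq_le_sum_mul_sum_of_sq_le_mul univ (fun e _ => hw e)
      (fun e _ => mul_nonneg (hw e) (sq_nonneg _)) fun e _ => ?_
    rw [mul_pow, sq_abs]; exact le_of_eq (by ring)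
  have hsumg : ∑ i, g i ≤ 4 * √(Fintype.card κ) := by
    simp only [hg]
    rw [sum_add_distrib, sum_add_distrib, sum_ite_eq, sum_ite_eq, hsumT]
    simp; linarith
  have hsumg2 : ∑ i, g i ^ 2 ≤ 12 * √(Fintype.card κ) := by
    calc ∑ i, g i ^ 2 ≤ ∑ i, 3 * g i := sum_le_sum fun i _ => by nlinarith [hg0 i, hg3 i]
      _ ≤ _ := by rw [← mul_sum]; linarith
  have hspg : ∑ i, sp i * g i = ∑ e, w e * |f e| * (sp (c (src e)) + sp (c (dst e))) +
      (sp (c u) + sp (c v)) := by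
    simp only [hg, hT, mul_add, sum_add_distrib, mul_sum]
    congr 1
    · congr 1 <;>
      · rw [sum_comm]
        refine sum_congr rfl fun e _ => ?_
        simp [mul_comm]
    · simp
  -- Conservation of the current holds for cluster potentials only, so it is tested on `y`; passing
  -- from `y` to `x` costs `sp` at each contact with a cluster.
  have hdrop : x u - x v ≤ ∑ e, w e * f e * (x (src e) - x (dst e)) + ∑ i, sp i * g i := by
    have h1 : ∑ e, w e * f e * (y (c (src e)) - y (c (dst e))) ≤
        ∑ e, (w e * f e * (x (src e) - x (dst e)) +
          w e * |f e| * (sp (c (src e)) + sp (c (dst e)))) := by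
      refine sum_le_sum fun e _ => ?_
      have h2 : f e * ((y (c (src e)) - y (c (dst e))) - (x (src e) - x (dst e))) ≤
          |f e| * (sp (c (src e)) + sp (c (dst e))) := by
        refine (le_abs_self _).trans ?_
        rw [abs_mul]
        refine mul_le_mul_of_nonneg_left ?_ (abs_nonneg _)
        have h3 := abs_le.1 (hsp (src e))
        have h4 := abs_le.1 (hsp (dst e))
        rw [abs_le]; constructor <;> linarith
      nlinarith [mul_le_mul_of_nonneg_left h2 (hw e)]
    rw [hp y, sum_add_distrib] at h1
    have h3 := abs_le.1 (hsp u)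
    have h4 := abs_le.1 (hsp v)
    rw [hspg]
    linarith
  -- AM-GM here and in the next bound turns the pairings into flow energy plus energy of `x`; by
  -- `hx` the latter is absorbed by half of `2 * (x u - x v)`.
  have h1 : 2 * ∑ e, w e * f e * (x (src e) - x (dst e)) ≤
      ∑ e, w e * f e ^ 2 + ∑ e, w e * (x (src e) - x (dst e)) ^ 2 := by
    rw [mul_sum, ← sum_add_distrib]
    refine sum_le_sum fun e _ => ?_
    nlinarith [mul_nonneg (hw e) (sq_nonneg (f e - (x (src e) - x (dst e))))]
  have h2 : 2 * ∑ i, sp i * g i ≤ D * ∑ i, g i ^ 2 + ∑ i, E i := by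
    rw [mul_sum, mul_sum, ← sum_add_distrib]
    refine sum_le_sum fun i _ => ?_
    have h3 := hE i
    have h4 : D * (2 * (sp i * g i)) ≤ D * (D * g i ^ 2 + E i) := by
      nlinarith [sq_nonneg (sp i - D * g i)]
    exact le_of_mul_le_mul_left h4 hD
  nlinarith [mul_le_mul_of_nonneg_left hsumg2 hD.le]

/-! ### Splitting the energy of the graph along clusters. -/

theorem effRes_comm {V : Type*} [Fintype V] (G : SimpleGraph V) (u v : V) :
    effRes G u v = effRes G v u := by
  classical
  have h : (Pi.single u 1 - Pi.single v 1 : V → ℝ) = -(Pi.single v 1 - Pi.single u 1) := by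
    rw [neg_sub]
  by_cases hr : G.Reachable u v
  · rw [effRes, effRes, if_pos hr, if_pos hr.symm, h, mulVec_neg, neg_dotProduct_neg]
  · rw [effRes, effRes, if_neg hr, if_neg fun h' => hr h'.symm]

theorem Fintype.sum_subtype_eq_sum_ite {V : Type*} [Fintype V] (S : Set V) [Fintype S]
    [DecidablePred (· ∈ S)] (f : V → ℝ) : ∑ a : S, f a = ∑ a, if a ∈ S then f a else 0 := by
  rw [← sum_filter]
  exact (sum_subtype _ (by simp) f).symm

open Classical in
theorem SimpleGraph.dirichletEnergy_induce {V : Type*} [Fintype V] (G : SimpleGraph V)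
    (S : Set V) [Fintype S] (x : V → ℝ) :
    (G.induce S).dirichletEnergy (fun a => x a) =
      (∑ a, ∑ b, if a ∈ S ∧ b ∈ S ∧ G.Adj a b then (x a - x b) ^ 2 else 0) / 2 := by
  rw [SimpleGraph.dirichletEnergy]
  congr 1
  simp only [SimpleGraph.comap_adj, Function.Embedding.subtype_apply]
  rw [Fintype.sum_subtype_eq_sum_ite S
    (fun a => ∑ b : S, if G.Adj a b then (x a - x b) ^ 2 else 0)]
  refine sum_congr rfl fun a _ => ?_
  rw [Fintype.sum_subtype_eq_sum_ite S (fun b => if G.Adj a b then (x a - x b) ^ 2 else 0)]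
  split_ifs with ha
  · refine sum_congr rfl fun b _ => ?_
    by_cases hb : b ∈ S <;> simp [ha, hb]
  · simp [ha]

open Classical in
-- Edges of `K` and edges inside clusters are disjoint families of edges of `G`. The weight `1 / 2`
-- compensates for ordered pairs counting each edge twice.
theorem SimpleGraph.sum_add_dirichletEnergy_induce_le {V κ : Type*} [Fintype V] [Fintype κ]
    {G K : SimpleGraph V} (hKG : K ≤ G) (c : V → κ) (hK : ∀ a b, K.Adj a b → c a ≠ c b)
    (x : V → ℝ) :
    ∑ e : V × V, (if K.Adj e.1 e.2 then (1 / 2 : ℝ) else 0) * (x e.1 - x e.2) ^ 2 +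
      ∑ i, (G.induce (c ⁻¹' {i})).dirichletEnergy (fun a => x a) ≤ G.dirichletEnergy x := by
  simp only [SimpleGraph.dirichletEnergy_induce]
  rw [← sum_div, sum_comm, Fintype.sum_prod_type, SimpleGraph.dirichletEnergy, sum_div, sum_div,
    ← sum_add_distrib]
  refine sum_le_sum fun a _ => ?_
  rw [sum_comm, sum_div, sum_div, ← sum_add_distrib]
  refine sum_le_sum fun b _ => ?_
  have h1 : (∑ i, if a ∈ c ⁻¹' {i} ∧ b ∈ c ⁻¹' {i} ∧ G.Adj a b then (x a - x b) ^ 2 else 0) =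
      if c a = c b ∧ G.Adj a b then (x a - x b) ^ 2 else 0 := by
    rw [sum_eq_single (c a)]
    · simp [eq_comm]
    · intro i _ hi
      simp [Ne.symm hi]
    · simp
  rw [h1]
  have h2 := sq_nonneg (x a - x b)
  by_cases hk : K.Adj a b
  · simp [hk, hK a b hk, hKG hk]; linarith
  · by_cases hg : G.Adj a b <;> by_cases hc : c a = c b <;> simp [hk, hg, hc]
    positivity

open Classical in
theorem SimpleGraph.sum_prod_ite_adj {V : Type*} [Fintype V] (K : SimpleGraph V) :
    ∑ e : V × V, (if K.Adj e.1 e.2 then (1 / 2 : ℝ) else 0) = K.edgeSet.ncard := by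
  have h := K.sum_degrees_eq_twice_card_edges
  have h1 : K.edgeSet.ncard = K.edgeFinset.card := by
    rw [← SimpleGraph.coe_edgeFinset, Set.ncard_coe_finset]
  have h2 : ∑ a, (K.degree a : ℝ) = 2 * K.edgeFinset.card := by exact_mod_cast h
  rw [h1, Fintype.sum_prod_type]
  have h3 : ∀ a, (∑ b, if K.Adj a b then (1 / 2 : ℝ) else 0) = K.degree a / 2 := by
    intro a
    rw [← sum_filter, sum_const, nsmul_eq_mul, ← SimpleGraph.card_neighborFinset_eq_degree,
      SimpleGraph.neighborFinset_eq_filter]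
    ring
  simp only [h3, ← sum_div, h2]
  ring

/-- If every cluster has small induced resistance diameter, then a subgraph whose edges join
distinct clusters and have large effective resistance in the whole graph has few edges. -/
theorem SimpleGraph.ncard_edgeSet_mul_le {V κ : Type*} [Fintype V] [Fintype κ]
    {G K : SimpleGraph V} (hKG : K ≤ G) (c : V → κ) (hK : ∀ a b, K.Adj a b → c a ≠ c b)
    {D β : ℝ} (hD : 0 < D) (hdiam : ∀ i, indEffDiam G (c ⁻¹' {i}) ≤ (D : EReal))
    (hβ : ∀ a b, K.Adj a b → (β : EReal) ≤ effRes G a b) :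
    (K.edgeSet.ncard : ℝ) * (β - 12 * D * √(Fintype.card κ)) ≤ Fintype.card κ := by
  classical
  rcases Nat.eq_zero_or_pos K.edgeSet.ncard with h0 | h0
  · simp [h0]
  have hdot : ∀ (e : V × V) (z : κ → ℝ),
      (Pi.single (c e.1) 1 - Pi.single (c e.2) 1 : κ → ℝ) ⬝ᵥ z = z (c e.1) - z (c e.2) :=
    fun e z => by simp [sub_dotProduct]
  have hsum := K.sum_prod_ite_adj
  have hw : ∀ e : V × V, 0 ≤ (if K.Adj e.1 e.2 then (1 / 2 : ℝ) else 0) := fun e => by positivity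
  obtain ⟨e, he, p, hp, hr⟩ := exists_dotProduct_le_of_weighted_family
    (fun e : V × V => if K.Adj e.1 e.2 then (1 / 2 : ℝ) else 0) hw
    (by rw [hsum]; exact_mod_cast h0)
    (fun e => (Pi.single (c e.1) 1 - Pi.single (c e.2) 1 : κ → ℝ))
  simp only [hdot] at hp hr
  obtain ⟨u, v⟩ := e
  have huv : K.Adj u v := by
    by_contra h
    simp [h] at he
  have : Nonempty V := ⟨u⟩
  have : Nonempty κ := ⟨c u⟩
  obtain ⟨x, hLx, hRx⟩ := exists_potential_of_reachable (hKG huv).reachable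
  have hβx := hβ u v huv
  rw [hRx, EReal.coe_le_coe_iff] at hβx
  have hEx : G.dirichletEnergy x = x u - x v := by
    rw [G.dirichletEnergy_eq_dotProduct, hLx]
    simp [dotProduct_sub]
  have hmain := potential_drop_le_add hw Prod.fst Prod.snd c (hK u v huv) hp hr hD
    -- `y` samples `x` at one representative per cluster; its value on an empty cluster is arbitrary
    -- and harmless.
    (x := x) (y := fun i => x (Function.invFun c i))
    (sp := fun i => √(D * (G.induce (c ⁻¹' {i})).dirichletEnergy (fun a => x a)))
    (E := fun i => (G.induce (c ⁻¹' {i})).dirichletEnergy (fun a => x a))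
    (fun a => by
      refine Real.abs_le_sqrt ?_
      have h1 : c (Function.invFun c (c a)) = c a := Function.invFun_eq ⟨a, rfl⟩
      refine sq_sub_le_mul_dirichletEnergy (u := (⟨a, rfl⟩ : c ⁻¹' {c a}))
        (v := ⟨Function.invFun c (c a), h1⟩) hD ?_ (fun a => x a)
      refine le_trans ?_ (hdiam (c a))
      rw [indEffDiam]
      convert le_iSup₂ (f := fun (u v : c ⁻¹' {c a}) => effRes (G.induce (c ⁻¹' {c a})) u v)
        ⟨a, rfl⟩ ⟨Function.invFun c (c a), h1⟩)
    (fun i => by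
      rw [Real.sq_sqrt (mul_nonneg hD.le (SimpleGraph.dirichletEnergy_nonneg _ _))])
    (by rw [← hEx]; exact SimpleGraph.sum_add_dirichletEnergy_induce_le hKG c hK x)
  rw [hsum] at hr
  refine le_trans (mul_le_mul_of_nonneg_left ?_ (Nat.cast_nonneg _)) hr
  linarith

/-! ### Choice of the exceptional set and numerical constants. -/

theorem mainTheorem9 {V : Type*} [Fintype V] (G : SimpleGraph V) (Δ β : ℝ) (k : ℕ)
    (hk : 1 ≤ k) (hΔ0 : 0 < Δ) (hβ0 : 0 < β)
    (hΔ : Δ < β / (400 * Real.sqrt k))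
    (hβ : β * Real.log (Fintype.card V) < 1)
    (C : Fin k → Set V) (hdisj : Pairwise fun i j => Disjoint (C i) (C j))
    (hcover : ⋃ i, C i = Set.univ)
    (hdiam : ∀ i, indEffDiam G (C i) ≤ (Δ : EReal)) :
    ∃ A : Finset (Fin k),
      (A.card : ℝ) ≤ 8 * Real.sqrt k * Real.log (Fintype.card V) ∧
      ((heavyLightEdges G C β A).ncard : ℝ) ≤ k * Real.log (Fintype.card V) / β := by
  classical
  have hex : ∀ a, ∃ i, a ∈ C i := fun a => by
    have : a ∈ ⋃ i, C i := by rw [hcover]; trivial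
    simpa using this
  choose c hc using hex
  have huniq : ∀ {a i}, a ∈ C i → c a = i := fun {a i} h => by
    by_contra hne
    exact Set.disjoint_left.1 (hdisj hne) (hc a) h
  have hCc : ∀ i, C i = c ⁻¹' {i} := fun i => by
    ext a
    exact ⟨fun h => huniq h, fun h => by rw [← show c a = i from h]; exact hc a⟩
  have hk1 : 1 ≤ √(k : ℝ) := by rw [Real.one_le_sqrt]; exact_mod_cast hk
  have hlog0 : 0 ≤ Real.log (Fintype.card V) := Real.log_natCast_nonneg _
  rcases Nat.lt_or_ge (Fintype.card V) 2 with hn2 | hn2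
  · refine ⟨∅, by simpa using by positivity, ?_⟩
    have : heavyLightEdges G C β ∅ = ∅ := by
      rw [Set.eq_empty_iff_forall_notMem]
      rintro - ⟨u, v, -, h, -⟩
      exact h.ne (Fintype.card_le_one_iff.1 (by omega) u v)
    rw [this, Set.ncard_empty]
    simpa using by positivity
  rcases Nat.lt_or_ge (Fintype.card V) 3 with hn | hn
  -- Here `log 2 < 1 / 0.97`, so the edge bound is too weak; discarding all nonempty clusters, at
  -- most two, is affordable since `8 * log 2 > 2`.
  · refine ⟨univ.image c, ?_, ?_⟩
    · have h2 : Fintype.card V = 2 := by omega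
      have hcard : ((univ.image c).card : ℝ) ≤ 2 := by
        exact_mod_cast (card_image_le (s := univ) (f := c)).trans (by simp [h2])
      rw [h2]
      push_cast
      nlinarith [Real.log_two_gt_d9]
    · have : heavyLightEdges G C β (univ.image c) = ∅ := by
        rw [Set.eq_empty_iff_forall_notMem]
        rintro - ⟨u, v, -, -, -, i, j, -, hi, -, hu, -⟩
        exact hi (by simp [← huniq hu])
      rw [this, Set.ncard_empty]
      simpa using by positivity
  · refine ⟨∅, by simpa using by positivity, ?_⟩
    set H := heavyLightEdges G C β ∅ with hH
    have hmem : ∀ {a b}, s(a, b) ∈ H → G.Adj a b ∧ (β : EReal) ≤ effRes G a b ∧ c a ≠ c b := by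
      rintro a b ⟨u, v, he, hadj, hR, i, j, hij, -, -, hu, hv⟩
      have hne : c u ≠ c v := by rwa [huniq hu, huniq hv]
      rcases Sym2.eq_iff.1 he with ⟨rfl, rfl⟩ | ⟨rfl, rfl⟩
      · exact ⟨hadj, hR, hne⟩
      · exact ⟨hadj.symm, effRes_comm G _ _ ▸ hR, hne.symm⟩
    have hedge : (SimpleGraph.fromEdgeSet H).edgeSet = H := by
      rw [SimpleGraph.edgeSet_fromEdgeSet, sdiff_eq_left, Set.disjoint_left]
      rintro - ⟨u, v, rfl, h, -⟩
      simpa using h.ne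
    have hmain := SimpleGraph.ncard_edgeSet_mul_le (G := G) (K := SimpleGraph.fromEdgeSet H)
      (fun a b h => (hmem h.1).1) c (fun a b h => (hmem h.1).2.2) hΔ0
      (fun i => hCc i ▸ hdiam i) (fun a b h => (hmem h.1).2.1)
    rw [hedge, Fintype.card_fin] at hmain
    have hlog : 1.09 ≤ Real.log (Fintype.card V) := by
      have h3 : (3 : ℝ) ≤ Fintype.card V := by exact_mod_cast hn
      refine le_trans ?_ (Real.log_le_log (by norm_num) h3)
      -- `log 3 = 1 + log (3 / e) ≥ 2 - e / 3 > 1.09`.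
      have h4 := Real.one_sub_inv_le_log_of_pos (x := 3 / Real.exp 1) (by positivity)
      rw [Real.log_div (by norm_num) (Real.exp_pos 1).ne', Real.log_exp, inv_div] at h4
      linarith [Real.exp_one_lt_d9]
    have h5 : Δ * (400 * √k) < β := (lt_div_iff₀ (by positivity)).1 hΔ
    rw [le_div_iff₀ hβ0]
    have h6 : (H.ncard : ℝ) * (0.97 * β) ≤ k :=
      (mul_le_mul_of_nonneg_left (by linarith) (Nat.cast_nonneg _)).trans hmain
    have h7 : (k : ℝ) * 1.09 ≤ k * Real.log (Fintype.card V) :=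
      mul_le_mul_of_nonneg_left hlog (Nat.cast_nonneg _)
    linarith
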